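/- Let $G_0$ be a connected (finite-dimensional, real) Lie group with Lie algebra $\mathfrak g_0$, let $\mathfrak g=\mathfrak g_0\otimes_{\mathbb R}\mathbb C$, $n=\dim_{\mathbb C}\mathfrak g$, and let $\mathfrak g^*=\mathfrak g_0^*+i\,\mathfrak g_0^*$ be the complex dual of $\mathfrak g$, with the complex conjugation $z\mapsto\bar z$ given by $\mathfrak g_0$ and with the action of $G_0$ that is the coadjoint action on both real and imaginary parts. For $z\in\mathfrak g^*$ let $c(z)$ be the skew form $(u,w)\mapsto z([u,w])$ on $\mathfrak g=(T^{1,0}_z\mathfrak g^*)^*$ (the value at $z$ of the linear holomorphic Poisson bivector $c=c_{ij}^kz_k\,\partial_{z_i}\wedge\partial_{z_j}$), and let $\tilde c(z)=c(\bar z)$. Put - $R_0=\max_z\operatorname{rank}c(z)$ and $r=\operatorname{rank}\mathfrak g:=n-R_0$; - $\operatorname{Sing}\mathfrak g^*=\{z:\operatorname{rank}c(z)<R_0\}$, and $\mathcal C=\{z:\lambda_1z+\lambda_2\bar z\in\operatorname{Sing}\mathfrak g^*\text{ for some }(\lambda_1,\lambda_2)\in\mathbb C^2\setminus\{(0,0)\}\}$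 (the incompleteness set); - $\mu(z)=\dim_{\mathbb C}(\ker c(z)\cap\ker\tilde c(z))$ and $\mu=\min_{z}\mu(z)$ (the trivial Kronecker dimension of $\mathfrak g$); - $\mathcal R$, the Kronecker irregularity set: the smallest real algebraic subset of $\mathfrak g^*$ that contains $\mathcal C$ and is such that $\mu(z)=\mu$ for all $z\notin\mathcal R$. Let $\mathcal O\subset\mathfrak g^*$ be a $G_0$-orbit lying in the complement of $\mathcal R$, with tangent spaces $T_z\mathcal O\subset\mathfrak g^*$ (images of the differentials at $1$ of the orbit maps $g\mapsto z\cdot g$), and for $z\in\mathcal O$ let $T^{1,0}_z\mathcal O=(T_z\mathcal O\otimes_{\mathbb R}\mathbb C)\cap T^{1,0}_z\mathfrak g^*$. Then, for every $z\in\mathcal O$: (i) $\dim_{\mathbb C}T^{1,0}_z\mathcal O=r-\mu$; in particular, if $\mathfrak g$ is semisimple, then $\dim_{\mathbb C}T^{1,0}_z\mathcal O=r$; (ii) $\dim_{\mathbb R}\mathcal O=\dim_{\mathbb R}T_z\mathcal O=n-\mu$. -/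

import Mathlib

open scoped Manifold ContDiff TensorProduct

noncomputable section

/-! ### The canonical pair of bivectors on the dual of a complexified Lie algebra

`L` is a real Lie algebra `𝔤₀`, and `𝔤 = ℂ ⊗[ℝ] L` its complexification. The complex dual `𝔤^*`
is identified with the space `L →L[ℝ] ℂ` of real-linear forms `z = a + i b` (`a, b ∈ 𝔤₀^*`) through
`ℂ`-linear extension; the complex conjugation of `𝔤^*` with respect to the real form is then
`z ↦ conj ∘ z`. -/

section Algebra

/-- The complexification `𝔤` of `𝔤₀`. -/
abbrev Complexified (L : Type*) [AddCommGroup L] [Module ℝ L] : Type _ := ℂ ⊗[ℝ] L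

/-- The complex dual `𝔤^* = 𝔤₀^* + i 𝔤₀^*` of the complexification. -/
abbrev ComplexDual (L : Type*) [AddCommGroup L] [Module ℝ L] [TopologicalSpace L] : Type _ :=
  L →L[ℝ] ℂ

variable {L : Type*} [LieRing L] [LieAlgebra ℝ L] [TopologicalSpace L]

/-- The `ℂ`-linear form on `𝔤` given by `z ∈ 𝔤^*`. -/
def ComplexDual.extend (z : ComplexDual L) : Complexified L →ₗ[ℂ] ℂ :=
  LinearMap.liftBaseChange ℂ (z : L →ₗ[ℝ] ℂ)

/-- The complex conjugation of `𝔤^*` with respect to the real form. -/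
def ComplexDual.conj (z : ComplexDual L) : ComplexDual L :=
  (Complex.conjCLE : ℂ →L[ℝ] ℂ).comp z

/-- The holomorphic linear bivector `c = c_{ij}^k z_k ∂_i ∧ ∂_j` on `𝔤^*`, at the point `z`, as the
sharp map from `(T_z^{1,0} 𝔤^*)^* = 𝔤` to `T_z^{1,0} 𝔤^* = 𝔤^*`: it takes `u` to `w ↦ z ([u, w])`. -/
def linearBivector (z : ComplexDual L) :
    Complexified L →ₗ[ℂ] Module.Dual ℂ (Complexified L) :=
  (LieModule.toEnd ℂ (Complexified L) (Complexified L) :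
    Complexified L →ₗ[ℂ] Module.End ℂ (Complexified L)).compr₂ z.extend

/-- The bivector `c̃ = c_{ij}^k z̄_k ∂_i ∧ ∂_j` on `𝔤^*`. -/
def conjBivector (z : ComplexDual L) :
    Complexified L →ₗ[ℂ] Module.Dual ℂ (Complexified L) :=
  linearBivector z.conj

/-- The rank of `c` at `z`, which is the complex dimension of the symplectic leaf through `z`. -/
def bivectorRank (z : ComplexDual L) : ℕ :=
  Module.finrank ℂ (LinearMap.range (linearBivector z))

variable (L) in
/-- The rank of `c`: the maximum of its ranks at all points. -/
def maxBivectorRank : ℕ := ⨆ z : ComplexDual L, bivectorRank z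

variable (L) in
/-- The rank of `𝔤`: the corank of `c`, i.e. the complex codimension of the symplectic leaves of
maximal dimension. -/
def algebraRank : ℕ := Module.finrank ℂ (Complexified L) - maxBivectorRank L

variable (L) in
/-- The union `Sing 𝔤^*` of the symplectic leaves of nonmaximal dimension. -/
def singularSet : Set (ComplexDual L) := {z | bivectorRank z < maxBivectorRank L}

variable (L) in
/-- The incompleteness set: the points `z` such that some nontrivial complex combination of `z` and
`z̄` is singular. -/
def incompletenessSet : Set (ComplexDual L) :=
  {z | ∃ a b : ℂ, (a, b) ≠ (0, 0) ∧ a • z + b • z.conj ∈ singularSet L}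

/-- The number `μ(z) = dim (ker c(z))^{1,0} ∩ (ker c̃(z))^{1,0}`. -/
def kroneckerDimAt (z : ComplexDual L) : ℕ :=
  Module.finrank ℂ ↥(LinearMap.ker (linearBivector z) ⊓ LinearMap.ker (conjBivector z))

variable (L) in
/-- The trivial Kronecker dimension `μ` of `𝔤`: the minimal value of `μ(z)`. -/
def trivialKroneckerDim : ℕ := ⨅ z : ComplexDual L, kroneckerDimAt z

/-- Real algebraic subsets of a finite-dimensional real vector space: the common zero sets of
families of real polynomials in the linear coordinates. -/
def IsRealAlgebraic {V : Type*} [AddCommGroup V] [Module ℝ V] (S : Set V) : Prop :=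
  ∃ P : Set (MvPolynomial (Module.Dual ℝ V) ℝ),
    S = {x | ∀ p ∈ P, MvPolynomial.eval (fun ℓ : Module.Dual ℝ V => ℓ x) p = 0}

/-- The property that characterizes the Kronecker irregularity set as the least set having it:
`S` is real algebraic, contains the incompleteness set, and `μ(z)` is constant and minimal outside
of `S`. -/
structure HasKroneckerProperty (S : Set (ComplexDual L)) : Prop where
  isRealAlgebraic : IsRealAlgebraic S
  incompletenessSet_subset : incompletenessSet L ⊆ S
  eq_trivialKroneckerDim : ∀ z ∉ S, kroneckerDimAt z = trivialKroneckerDim L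

variable (L) in
/-- The Kronecker irregularity set: the least set with the property above. -/
def kroneckerIrregularitySet : Set (ComplexDual L) :=
  ⋂₀ {S | HasKroneckerProperty S}

variable (L) in
/-- The least set with the Kronecker property exists. -/
theorem isLeast_kroneckerIrregularitySet :
    IsLeast {S : Set (ComplexDual L) | HasKroneckerProperty S} (kroneckerIrregularitySet L) := by
  refine ⟨⟨?_, ?_, ?_⟩, fun S hS => Set.sInter_subset_of_mem hS⟩
  · refine ⟨{p | ∃ S : Set (ComplexDual L), HasKroneckerProperty S ∧
      ∀ x ∈ S, MvPolynomial.eval (fun ℓ : Module.Dual ℝ (ComplexDual L) => ℓ x) p = 0}, ?_⟩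
    ext x
    constructor
    · rintro hx p ⟨S, hS, hp⟩
      exact hp x (hx S hS)
    · intro hx S hS
      obtain ⟨P, hP⟩ := hS.isRealAlgebraic
      rw [hP]
      intro p hp
      refine hx p ⟨S, hS, fun y hy => ?_⟩
      rw [hP] at hy
      exact hy p hp
  · exact fun z hz S hS => hS.incompletenessSet_subset hz
  · intro z hz
    simp only [kroneckerIrregularitySet, Set.mem_sInter, not_forall] at hz
    obtain ⟨S, hS, hzS⟩ := hz
    exact hS.eq_trivialKroneckerDim z hzS

end Algebra

/-! ### The `(1,0)`-part of a real subspace of a complex vector space -/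

section CR

variable (V : Type*) [AddCommGroup V] [Module ℝ V] [Module ℂ V] [IsScalarTower ℝ ℂ V]

/-- The complex structure `J` (multiplication by `i`) of a complex vector space. -/
def complexStructure : V →ₗ[ℝ] V := (LinearMap.lsmul ℂ V Complex.I).restrictScalars ℝ

/-- The holomorphic tangent space `V^{1,0} ⊆ ℂ ⊗[ℝ] V`: the `i`-eigenspace of `J`. -/
def holomorphicTangent : Submodule ℂ (ℂ ⊗[ℝ] V) :=
  Module.End.eigenspace ((complexStructure V).baseChange ℂ) Complex.I

variable {V}

/-- `T^{1,0} = T^ℂ ∩ V^{1,0}` for a real subspace `T` of `V`. -/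
def holomorphicPart (T : Submodule ℝ V) : Submodule ℂ (ℂ ⊗[ℝ] V) :=
  T.baseChange ℂ ⊓ holomorphicTangent V

end CR

/-! ### Coadjoint orbits of a real Lie group in the complexified dual -/

section Orbits

/-- `minSmoothness ℝ 3`, the smoothness at which Mathlib defines the Lie algebra of a real Lie
group, equals `3`. -/
instance : ENat.LEInfty (minSmoothness ℝ 3) :=
  ⟨by rw [minSmoothness_of_isRCLikeNormedField]; exact ENat.LEInfty.out⟩

variable {E : Type*} [NormedAddCommGroup E] [NormedSpace ℝ E]
  {G : Type*} [TopologicalSpace G] [ChartedSpace E G] [Group G]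

/-- The adjoint action of `g` on the Lie algebra: the differential at `1` of the conjugation
`x ↦ g x g⁻¹` (which fixes `1`). -/
def adjointMap (g : G) : GroupLieAlgebra 𝓘(ℝ, E) G →L[ℝ] GroupLieAlgebra 𝓘(ℝ, E) G :=
  mfderiv 𝓘(ℝ, E) 𝓘(ℝ, E) (fun x : G => g * x * g⁻¹) 1

/-- The (right) action of `g ∈ G₀` on `𝔤^* = 𝔤₀^* + i 𝔤₀^*`: the coadjoint action on the real and on
the imaginary part. -/
def coadjointAct (z : ComplexDual (GroupLieAlgebra 𝓘(ℝ, E) G)) (g : G) :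
    ComplexDual (GroupLieAlgebra 𝓘(ℝ, E) G) :=
  z.comp (adjointMap g)

/-- The `G₀`-orbit through `z`. -/
def coadjointOrbit (z : ComplexDual (GroupLieAlgebra 𝓘(ℝ, E) G)) :
    Set (ComplexDual (GroupLieAlgebra 𝓘(ℝ, E) G)) :=
  Set.range (coadjointAct z)

/-- The orbit map `g ↦ z · g`. Its values lie in the dual of the Lie algebra, whose underlying
normed space is the model space `E`; this is how `𝔤^*` is viewed as a normed space. -/
def orbitMap (z : ComplexDual (GroupLieAlgebra 𝓘(ℝ, E) G)) : G → (E →L[ℝ] ℂ) :=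
  coadjointAct z

/-- The differential at `1` of the orbit map of `z`. -/
def orbitDifferential (z : ComplexDual (GroupLieAlgebra 𝓘(ℝ, E) G)) : E →L[ℝ] (E →L[ℝ] ℂ) :=
  mfderiv 𝓘(ℝ, E) 𝓘(ℝ, E →L[ℝ] ℂ) (orbitMap z) 1

/-- The tangent space `T_z O` at `z` of the orbit `O` of `z`, as an immersed submanifold of `𝔤^*`:
the image of the differential at `1` of the orbit map `g ↦ z · g`. -/
def orbitTangent (z : ComplexDual (GroupLieAlgebra 𝓘(ℝ, E) G)) : Submodule ℝ (E →L[ℝ] ℂ) :=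
  LinearMap.range (orbitDifferential z : E →ₗ[ℝ] (E →L[ℝ] ℂ))

end Orbits

end

/-!
The differential at `1` of the orbit map of `z` is `D v = z ([v, ·])`, because the derivative of
`Ad` at `1` is `ad`: in a chart, both are the antisymmetrized mixed second derivative of the
product. Complexify `D` and split its values into `(1,0)`- and `(0,1)`-components: these are the
forms `c(z)` and `c(z̄)`. Hence `ker D_ℂ = ker c(z) ∩ ker c̃(z)`, which gives the real dimension of
the orbit, and `T^{1,0}` is the image under `D_ℂ` of `ker c̃(z)`, which off the incompleteness set
has dimension `n - R₀`.

For semisimple `𝔤`, two elements with trivial common centralizer give, through the Killing form,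
`a` and `b` in `𝔤^*` with `ker c(a) ∩ ker c(b) = 0`. The pair `(a, b)` is the value at `t = i` of a
complex line `t ↦ (z + t w, z̄ + t w̄)`; the kernels also meet trivially at some real `t`, where the
pair consists of `z + t w` and its conjugate, so that `μ = 0`.
-/

section LinearAlgebra

theorem range_baseChange {R A M N : Type*} [CommSemiring R] [Semiring A] [Algebra R A]
    [AddCommMonoid M] [Module R M] [AddCommMonoid N] [Module R N] (f : M →ₗ[R] N) :
    LinearMap.range (f.baseChange A) = (LinearMap.range f).baseChange A := by
  have hf : f.baseChange A =
      (LinearMap.range f).subtype.baseChange A ∘ₗ f.rangeRestrict.baseChange A := by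
    rw [← LinearMap.baseChange_comp, LinearMap.subtype_comp_codRestrict]
  have hsurj : LinearMap.range (f.rangeRestrict.baseChange A) = ⊤ :=
    LinearMap.range_eq_top.mpr (LinearMap.lTensor_surjective A f.surjective_rangeRestrict)
  rw [hf, LinearMap.range_comp_of_range_eq_top _ hsurj]
  rfl

theorem liftBaseChange_comp_baseChange {R A M N P : Type*} [CommSemiring R] [CommSemiring A]
    [Algebra R A] [AddCommMonoid M] [Module R M] [AddCommMonoid N] [Module R N] [AddCommMonoid P]
    [Module R P] [Module A P] [IsScalarTower R A P] (ℓ : N →ₗ[R] P) (f : M →ₗ[R] N) :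
    ℓ.liftBaseChange A ∘ₗ f.baseChange A = (ℓ ∘ₗ f).liftBaseChange A := by
  ext x
  simp

theorem finrank_baseChange_submodule {K F M : Type*} [Field K] [Field F] [Algebra K F]
    [AddCommGroup M] [Module K M] (p : Submodule K M) :
    Module.finrank F (p.baseChange F) = Module.finrank K p := by
  rw [← (Submodule.toBaseChange.toLinearEquiv F p).finrank_eq, Module.finrank_baseChange]

theorem finrank_range_inf_ker_add_finrank_ker {K M N P : Type*} [DivisionRing K]
    [AddCommGroup M] [Module K M] [AddCommGroup N] [Module K N] [AddCommGroup P] [Module K P]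
    [FiniteDimensional K M] (f : M →ₗ[K] N) (g : N →ₗ[K] P) :
    Module.finrank K ↥(LinearMap.range f ⊓ LinearMap.ker g) + Module.finrank K (LinearMap.ker f) =
      Module.finrank K (LinearMap.ker (g ∘ₗ f)) := by
  have hker : LinearMap.ker f ≤ LinearMap.ker (g ∘ₗ f) := LinearMap.ker_le_ker_comp f g
  rw [← (f.domRestrict (LinearMap.ker (g ∘ₗ f))).finrank_range_add_finrank_ker,
    LinearMap.range_domRestrict, LinearMap.ker_comp, Submodule.map_comap_eq, LinearMap.domRestrict,
    LinearMap.ker_comp, ← LinearMap.ker_comp,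
    (Submodule.comapSubtypeEquivOfLe hker).finrank_eq]

theorem finite_setOf_not_injective_add_smul {K M N : Type*} [Field K] [AddCommGroup M] [Module K M]
    [FiniteDimensional K M] [AddCommGroup N] [Module K N] (P Q : M →ₗ[K] N) {s : K}
    (hs : Function.Injective (P + s • Q)) :
    {t : K | ¬ Function.Injective (P + t • Q)}.Finite := by
  obtain ⟨S, hS⟩ := (P + s • Q).exists_leftInverse_of_injective (LinearMap.ker_eq_bot.mpr hs)
  have hinj : Function.Injective fun t : K => -(t - s)⁻¹ := fun t t' h => by simpa using h
  refine ((Module.End.finite_hasEigenvalue (S ∘ₗ Q)).preimage hinj.injOn).subset fun t ht => ?_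
  obtain ⟨x, hx, hx0⟩ : ∃ x, (P + t • Q) x = 0 ∧ x ≠ 0 := by
    simpa [injective_iff_map_eq_zero] using ht
  have hts : t - s ≠ 0 := fun h => ht (by rwa [sub_eq_zero.mp h])
  have hxS : x + (t - s) • S (Q x) = 0 := by
    have hsplit : (P + t • Q) x = (P + s • Q) x + (t - s) • Q x := by
      simp only [LinearMap.add_apply, LinearMap.smul_apply]
      module
    have hSx : S ((P + s • Q) x) = x := LinearMap.congr_fun hS x
    rw [← hSx, ← map_smul, ← map_add, hSx, ← hsplit, hx, map_zero]
  refine Module.End.hasEigenvalue_of_hasEigenvector (x := x)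
    ⟨Module.End.mem_eigenspace_iff.mpr ?_, hx0⟩
  rw [neg_smul, eq_neg_iff_add_eq_zero, ← smul_eq_zero_iff_right hts, smul_add,
    smul_inv_smul₀ hts, add_comm]
  exact hxS

theorem exists_ofReal_injective_add_smul {M N : Type*} [AddCommGroup M] [Module ℂ M]
    [FiniteDimensional ℂ M] [AddCommGroup N] [Module ℂ N] (P Q : M →ₗ[ℂ] N) {s : ℂ}
    (hs : Function.Injective (P + s • Q)) :
    ∃ t : ℝ, Function.Injective (P + (t : ℂ) • Q) := by
  obtain ⟨t, ht⟩ := ((finite_setOf_not_injective_add_smul P Q hs).preimage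
    Complex.ofReal_injective.injOn).exists_notMem
  exact ⟨t, not_not.mp ht⟩

theorem exists_eq_one_tmul_add_I_tmul {V : Type*} [AddCommGroup V] [Module ℝ V] (ξ : ℂ ⊗[ℝ] V) :
    ∃ a b : V, ξ = 1 ⊗ₜ a + Complex.I ⊗ₜ b := by
  induction ξ with
  | zero => exact ⟨0, 0, by simp⟩
  | tmul s v =>
    refine ⟨s.re • v, s.im • v, ?_⟩
    rw [← TensorProduct.smul_tmul, ← TensorProduct.smul_tmul, ← TensorProduct.add_tmul]
    congr 1
    apply Complex.ext <;> simp
  | add ξ η hξ hη =>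
    obtain ⟨a, b, rfl⟩ := hξ
    obtain ⟨a', b', rfl⟩ := hη
    refine ⟨a + a', b + b', ?_⟩
    rw [TensorProduct.tmul_add, TensorProduct.tmul_add, add_add_add_comm]

end LinearAlgebra

section HolomorphicPart

open LinearMap

variable {V W : Type*} [AddCommGroup V] [Module ℝ V] [Module ℂ V]
  [AddCommGroup W] [Module ℝ W] [Module ℂ W] [IsScalarTower ℝ ℂ W]

variable {ℓ ℓ' : V →ₗ[ℝ] W}

theorem ker_liftBaseChange_inf_ker_liftBaseChange_eq_bot
    (hℓ : ∀ v, ℓ (Complex.I • v) = Complex.I • ℓ v) (hℓinj : Function.Injective ℓ)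
    (hℓ' : ∀ v, ℓ' (Complex.I • v) = -Complex.I • ℓ' v) (hℓ'inj : Function.Injective ℓ') :
    ker (ℓ.liftBaseChange ℂ) ⊓ ker (ℓ'.liftBaseChange ℂ) = ⊥ := by
  refine (Submodule.eq_bot_iff _).mpr fun ξ ⟨hξ, hξ'⟩ => ?_
  obtain ⟨a, b, rfl⟩ := exists_eq_one_tmul_add_I_tmul ξ
  have hadd : a + Complex.I • b = 0 := hℓinj (by simpa [hℓ] using hξ)
  have hsub : a - Complex.I • b = 0 := hℓ'inj (by simpa [hℓ'] using hξ')
  have ha : a = 0 := by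
    have : (2 : ℂ) • a = 0 := by linear_combination (norm := module) hadd + hsub
    simpa using this
  have hb : b = 0 := by simpa [ha] using hadd
  simp [ha, hb]

variable {U : Type*} [AddCommGroup U] [Module ℝ U]

theorem ker_baseChange_eq_inf (D : U →ₗ[ℝ] V)
    (hℓ : ∀ v, ℓ (Complex.I • v) = Complex.I • ℓ v) (hℓinj : Function.Injective ℓ)
    (hℓ' : ∀ v, ℓ' (Complex.I • v) = -Complex.I • ℓ' v) (hℓ'inj : Function.Injective ℓ') :
    ker (D.baseChange ℂ) =
      ker ((ℓ ∘ₗ D).liftBaseChange ℂ) ⊓ ker ((ℓ' ∘ₗ D).liftBaseChange ℂ) := by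
  simp only [← liftBaseChange_comp_baseChange, ker_comp]
  rw [← Submodule.comap_inf,
    ker_liftBaseChange_inf_ker_liftBaseChange_eq_bot hℓ hℓinj hℓ' hℓ'inj]
  rfl

variable [IsScalarTower ℝ ℂ V]

theorem liftBaseChange_complexStructure {c : ℂ}
    (hℓ : ∀ v, ℓ (Complex.I • v) = c • ℓ v) (ξ : ℂ ⊗[ℝ] V) :
    ℓ.liftBaseChange ℂ ((complexStructure V).baseChange ℂ ξ) = c • ℓ.liftBaseChange ℂ ξ := by
  suffices ℓ.liftBaseChange ℂ ∘ₗ (complexStructure V).baseChange ℂ = c • ℓ.liftBaseChange ℂ from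
    LinearMap.congr_fun this ξ
  ext v
  simpa [complexStructure] using hℓ v

theorem holomorphicTangent_eq_ker_liftBaseChange
    (hℓ : ∀ v, ℓ (Complex.I • v) = Complex.I • ℓ v) (hℓinj : Function.Injective ℓ)
    (hℓ' : ∀ v, ℓ' (Complex.I • v) = -Complex.I • ℓ' v) (hℓ'inj : Function.Injective ℓ') :
    holomorphicTangent V = ker (ℓ'.liftBaseChange ℂ) := by
  ext ξ
  rw [holomorphicTangent, Module.End.mem_eigenspace_iff, mem_ker]
  constructor
  · intro h
    have hJ := liftBaseChange_complexStructure hℓ' ξ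
    rw [h, map_smul, ← sub_eq_zero, ← sub_smul] at hJ
    exact (smul_eq_zero.mp hJ).resolve_left (by simp [← two_mul])
  · intro h
    rw [← sub_eq_zero, ← Submodule.mem_bot ℂ,
      ← ker_liftBaseChange_inf_ker_liftBaseChange_eq_bot hℓ hℓinj hℓ' hℓ'inj]
    constructor
    · rw [SetLike.mem_coe, mem_ker, map_sub, liftBaseChange_complexStructure hℓ, map_smul, sub_self]
    · rw [SetLike.mem_coe, mem_ker, map_sub, liftBaseChange_complexStructure hℓ', map_smul, h,
        smul_zero, smul_zero, sub_zero]

theorem finrank_holomorphicPart_range_add [FiniteDimensional ℝ U] (D : U →ₗ[ℝ] V)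
    (hℓ : ∀ v, ℓ (Complex.I • v) = Complex.I • ℓ v) (hℓinj : Function.Injective ℓ)
    (hℓ' : ∀ v, ℓ' (Complex.I • v) = -Complex.I • ℓ' v) (hℓ'inj : Function.Injective ℓ') :
    Module.finrank ℂ (holomorphicPart (range D)) + Module.finrank ℂ (ker (D.baseChange ℂ)) =
      Module.finrank ℂ (ker ((ℓ' ∘ₗ D).liftBaseChange ℂ)) := by
  rw [holomorphicPart, ← range_baseChange,
    holomorphicTangent_eq_ker_liftBaseChange hℓ hℓinj hℓ' hℓ'inj,
    finrank_range_inf_ker_add_finrank_ker, liftBaseChange_comp_baseChange]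

end HolomorphicPart

section Bivectors

open LinearMap

variable {L : Type*} [LieRing L] [LieAlgebra ℝ L] [TopologicalSpace L]

namespace ComplexDual

@[simp]
theorem extend_tmul (z : ComplexDual L) (s : ℂ) (x : L) : z.extend (s ⊗ₜ[ℝ] x) = s * z x := by
  simp [extend]

@[simp]
theorem conj_apply (z : ComplexDual L) (x : L) : z.conj x = starRingEnd ℂ (z x) := rfl

@[simp]
theorem conj_conj (z : ComplexDual L) : z.conj.conj = z := by
  ext x
  simp

theorem conj_add (z w : ComplexDual L) : (z + w).conj = z.conj + w.conj := by
  ext x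
  simp

theorem conj_smul (s : ℂ) (z : ComplexDual L) : (s • z).conj = starRingEnd ℂ s • z.conj := by
  ext x
  simp

/-- `ComplexDual.extend` as a linear map: the projection of a tangent vector of `𝔤^*` to its
`(1,0)`-component, on real tangent vectors. -/
noncomputable def extendₗ : ComplexDual L →ₗ[ℝ] Module.Dual ℂ (Complexified L) where
  toFun := extend
  map_add' z w := by ext x; simp
  map_smul' r z := by ext x; simp

/-- The map `z ↦ z̄.extend`: the projection of a tangent vector of `𝔤^*` to its `(0,1)`-component,
on real tangent vectors, the `(0,1)`-tangent space being identified with `𝔤^*` by conjugation. -/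
noncomputable def conjExtendₗ : ComplexDual L →ₗ[ℝ] Module.Dual ℂ (Complexified L) where
  toFun z := z.conj.extend
  map_add' z w := by ext x; simp
  map_smul' r z := by ext x; simp

theorem extendₗ_I_smul (z : ComplexDual L) :
    extendₗ (Complex.I • z) = Complex.I • extendₗ z := by
  ext x
  simp [extendₗ]

theorem conjExtendₗ_I_smul (z : ComplexDual L) :
    conjExtendₗ (Complex.I • z) = -Complex.I • conjExtendₗ z := by
  ext x
  simp [conjExtendₗ]

theorem extendₗ_injective : Function.Injective (extendₗ (L := L)) := fun z w h => by
  ext x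
  simpa [extendₗ] using LinearMap.congr_fun h (1 ⊗ₜ[ℝ] x)

theorem conjExtendₗ_injective : Function.Injective (conjExtendₗ (L := L)) := fun z w h => by
  rw [← conj_conj z, ← conj_conj w]
  exact congrArg conj (extendₗ_injective h)

end ComplexDual

theorem linearBivector_tmul_tmul (z : ComplexDual L) (s t : ℂ) (v w : L) :
    linearBivector z (s ⊗ₜ v) (t ⊗ₜ w) = s * t * z ⁅v, w⁆ := by
  simp [linearBivector]

theorem linearBivector_add (z w : ComplexDual L) :
    linearBivector (z + w) = linearBivector z + linearBivector w := by
  ext u v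
  simp [linearBivector_tmul_tmul]

theorem linearBivector_smul (s : ℂ) (z : ComplexDual L) :
    linearBivector (s • z) = s • linearBivector z := by
  ext u v
  simp [linearBivector_tmul_tmul]

section InfinitesimalAction

variable {z : ComplexDual L} {D : L →ₗ[ℝ] ComplexDual L}

theorem liftBaseChange_extendₗ_comp (hD : ∀ v w, D v w = z ⁅v, w⁆) :
    (ComplexDual.extendₗ ∘ₗ D).liftBaseChange ℂ = linearBivector z := by
  ext v w
  simp [ComplexDual.extendₗ, hD, linearBivector_tmul_tmul]

theorem liftBaseChange_conjExtendₗ_comp (hD : ∀ v w, D v w = z ⁅v, w⁆) :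
    (ComplexDual.conjExtendₗ ∘ₗ D).liftBaseChange ℂ = conjBivector z := by
  ext v w
  simp [ComplexDual.conjExtendₗ, hD, conjBivector, linearBivector_tmul_tmul]

theorem finrank_ker_baseChange_eq_kroneckerDimAt (hD : ∀ v w, D v w = z ⁅v, w⁆) :
    Module.finrank ℂ (ker (D.baseChange ℂ)) = kroneckerDimAt z := by
  rw [kroneckerDimAt, ← liftBaseChange_extendₗ_comp hD, ← liftBaseChange_conjExtendₗ_comp hD,
    ker_baseChange_eq_inf D ComplexDual.extendₗ_I_smul ComplexDual.extendₗ_injective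
      ComplexDual.conjExtendₗ_I_smul ComplexDual.conjExtendₗ_injective]

variable [FiniteDimensional ℝ L]

theorem finrank_range_add_kroneckerDimAt (hD : ∀ v w, D v w = z ⁅v, w⁆) :
    Module.finrank ℝ (range D) + kroneckerDimAt z = Module.finrank ℂ (Complexified L) := by
  rw [← finrank_ker_baseChange_eq_kroneckerDimAt hD, ← finrank_baseChange_submodule (F := ℂ),
    ← range_baseChange, finrank_range_add_finrank_ker]

theorem finrank_holomorphicPart_add_kroneckerDimAt (hD : ∀ v w, D v w = z ⁅v, w⁆) :
    Module.finrank ℂ (holomorphicPart (range D)) + kroneckerDimAt z =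
      Module.finrank ℂ (Complexified L) - bivectorRank z.conj := by
  rw [← finrank_ker_baseChange_eq_kroneckerDimAt hD,
    finrank_holomorphicPart_range_add D ComplexDual.extendₗ_I_smul ComplexDual.extendₗ_injective
      ComplexDual.conjExtendₗ_I_smul ComplexDual.conjExtendₗ_injective,
    liftBaseChange_conjExtendₗ_comp hD, conjBivector, bivectorRank,
    ← (linearBivector z.conj).finrank_range_add_finrank_ker, Nat.add_sub_cancel_left]

end InfinitesimalAction

theorem kroneckerDimAt_of_notMem_kroneckerIrregularitySet {z : ComplexDual L}
    (hz : z ∉ kroneckerIrregularitySet L) : kroneckerDimAt z = trivialKroneckerDim L :=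
  (isLeast_kroneckerIrregularitySet L).1.eq_trivialKroneckerDim z hz

theorem trivialKroneckerDim_le_kroneckerDimAt (z : ComplexDual L) :
    trivialKroneckerDim L ≤ kroneckerDimAt z :=
  ciInf_le (OrderBot.bddBelow _) z

variable [FiniteDimensional ℝ L]

theorem bivectorRank_le_maxBivectorRank (z : ComplexDual L) :
    bivectorRank z ≤ maxBivectorRank L :=
  le_ciSup ⟨_, Set.forall_mem_range.mpr fun _ => LinearMap.finrank_range_le _⟩ z

theorem bivectorRank_conj_of_notMem_kroneckerIrregularitySet {z : ComplexDual L}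
    (hz : z ∉ kroneckerIrregularitySet L) : bivectorRank z.conj = maxBivectorRank L := by
  refine (bivectorRank_le_maxBivectorRank _).eq_of_not_lt fun hlt => hz ?_
  refine (isLeast_kroneckerIrregularitySet L).1.incompletenessSet_subset ⟨0, 1, by simp, ?_⟩
  rwa [zero_smul ℂ z, one_smul ℂ z.conj, zero_add z.conj]

theorem finrank_holomorphicPart_add_trivialKroneckerDim {z : ComplexDual L}
    {D : L →ₗ[ℝ] ComplexDual L} (hD : ∀ v w, D v w = z ⁅v, w⁆)
    (hz : z ∉ kroneckerIrregularitySet L) :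
    Module.finrank ℂ (holomorphicPart (range D)) + trivialKroneckerDim L = algebraRank L := by
  rw [← kroneckerDimAt_of_notMem_kroneckerIrregularitySet hz,
    finrank_holomorphicPart_add_kroneckerDimAt hD,
    bivectorRank_conj_of_notMem_kroneckerIrregularitySet hz, algebraRank]

end Bivectors

section Semisimple

open LieAlgebra LieAlgebra.IsKilling LieModule

/-- The element `b` is the sum of one nonzero root vector for each root, the root `0` included: the
root vectors are linearly independent and the roots have no common zero. -/
theorem exists_forall_lie_eq_zero_imp_eq_zero {K 𝔤 : Type*} [Field K] [CharZero K] [LieRing 𝔤]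
    [LieAlgebra K 𝔤] [FiniteDimensional K 𝔤] [LieAlgebra.IsKilling K 𝔤] (H : LieSubalgebra K 𝔤)
    [H.IsCartanSubalgebra] [IsTriangularizable K H 𝔤] :
    ∃ b : 𝔤, ∀ x ∈ H, ⁅x, b⁆ = 0 → x = 0 := by
  choose e he he0 using fun α : Weight K H 𝔤 => α.exists_ne_zero
  have hind : LinearIndependent K e :=
    (LieSubmodule.iSupIndep_toSubmodule.mpr
      (iSupIndep_genWeightSpace' K H 𝔤)).linearIndependent _ he he0
  refine ⟨∑ α, e α, fun x hx hxb => ?_⟩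
  have hsum : ∑ α : Weight K H 𝔤, α ⟨x, hx⟩ • e α = 0 := by
    rw [← hxb, lie_sum]
    exact Finset.sum_congr rfl fun α _ => (lie_eq_smul_of_mem_rootSpace (he α) ⟨x, hx⟩).symm
  have hker : (⟨x, hx⟩ : H) ∈ ⨅ α : Weight K H 𝔤, α.ker :=
    (Submodule.mem_iInf _).mpr (Fintype.linearIndependent_iff.mp hind _ hsum)
  rw [iInf_ker_weight_eq_bot] at hker
  exact congrArg Subtype.val ((Submodule.mem_bot K).mp hker)

theorem exists_pair_common_centralizer_eq_zero (K 𝔤 : Type*) [Field K] [CharZero K]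
    [IsAlgClosed K] [LieRing 𝔤] [LieAlgebra K 𝔤] [FiniteDimensional K 𝔤]
    [LieAlgebra.IsKilling K 𝔤] :
    ∃ a b : 𝔤, ∀ x : 𝔤, ⁅a, x⁆ = 0 → ⁅b, x⁆ = 0 → x = 0 := by
  obtain ⟨a, ha⟩ := exists_isCartanSubalgebra_engel K 𝔤
  obtain ⟨b, hb⟩ := exists_forall_lie_eq_zero_imp_eq_zero (LieSubalgebra.engel K a)
  refine ⟨a, b, fun x hax hbx => hb x ?_ ?_⟩
  · exact (LieSubalgebra.mem_engel_iff K a x).mpr ⟨1, by simpa using hax⟩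
  · rw [← lie_skew, hbx, neg_zero]

variable {L : Type*} [LieRing L] [LieAlgebra ℝ L] [TopologicalSpace L]

theorem lie_eq_zero_of_linearBivector_eq_zero [LieAlgebra.IsKilling ℂ (Complexified L)]
    {c : ComplexDual L} {C u : Complexified L} (hc : c.extend = killingForm ℂ (Complexified L) C)
    (hu : linearBivector c u = 0) : ⁅C, u⁆ = 0 := by
  refine (killingForm_nondegenerate ℂ (Complexified L)).1 _ fun w => ?_
  rw [LieModule.traceForm_apply_lie_apply, ← hc]
  exact LinearMap.congr_fun hu w

theorem exists_add_I_smul_eq_and_conj_add_I_smul_conj_eq (a b : ComplexDual L) :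
    ∃ z w : ComplexDual L, z + Complex.I • w = a ∧ z.conj + Complex.I • w.conj = b := by
  refine ⟨(2⁻¹ : ℂ) • (a + b.conj), (-(2⁻¹ * Complex.I) : ℂ) • (a - b.conj), ?_, ?_⟩
  · ext x
    simp only [add_apply, sub_apply, smul_apply, ComplexDual.conj_apply, smul_eq_mul]
    linear_combination (-(a x - starRingEnd ℂ (b x)) / 2) * Complex.I_mul_I
  · ext x
    simp only [add_apply, sub_apply, smul_apply, ComplexDual.conj_apply, smul_eq_mul, map_mul,
      map_add, map_sub, map_neg, map_inv₀, map_ofNat, Complex.conj_I, Complex.conj_conj]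
    linear_combination ((starRingEnd ℂ (a x) - b x) / 2) * Complex.I_mul_I

theorem kroneckerDimAt_eq_zero_iff [FiniteDimensional ℝ L] {z : ComplexDual L} :
    kroneckerDimAt z = 0 ↔ Function.Injective ((linearBivector z).prod (conjBivector z)) := by
  rw [kroneckerDimAt, Submodule.finrank_eq_zero, ← LinearMap.ker_prod, LinearMap.ker_eq_bot]

/-- With `z + i w = a` and `z̄ + i w̄ = b`, the linear pencil through the pairs `(c(z), c(z̄))` and
`(c(w), c(w̄))` is injective at `t = i`, hence at some real `t`. -/
theorem trivialKroneckerDim_eq_zero_of_ker_inf_ker_eq_bot [FiniteDimensional ℝ L]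
    {a b : ComplexDual L}
    (hab : LinearMap.ker (linearBivector a) ⊓ LinearMap.ker (linearBivector b) = ⊥) :
    trivialKroneckerDim L = 0 := by
  obtain ⟨z, w, rfl, rfl⟩ := exists_add_I_smul_eq_and_conj_add_I_smul_conj_eq a b
  have hI : Function.Injective ((linearBivector z).prod (conjBivector z) +
      Complex.I • (linearBivector w).prod (conjBivector w)) := by
    rw [← LinearMap.ker_prod, LinearMap.ker_eq_bot, linearBivector_add, linearBivector_add,
      linearBivector_smul, linearBivector_smul] at hab
    exact hab
  obtain ⟨t, ht⟩ := exists_ofReal_injective_add_smul _ _ hI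
  refine Nat.le_zero.mp ((trivialKroneckerDim_le_kroneckerDimAt (z + (t : ℂ) • w)).trans_eq ?_)
  rw [kroneckerDimAt_eq_zero_iff, conjBivector, ComplexDual.conj_add, ComplexDual.conj_smul,
    Complex.conj_ofReal, linearBivector_add, linearBivector_add, linearBivector_smul,
    linearBivector_smul]
  exact ht

variable [FiniteDimensional ℝ L] [IsTopologicalAddGroup L] [ContinuousSMul ℝ L] [T2Space L]

theorem ComplexDual.extend_surjective :
    Function.Surjective (ComplexDual.extend : ComplexDual L → Module.Dual ℂ (Complexified L)) := by
  refine fun f => ⟨LinearMap.toContinuousLinearMap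
    (f.restrictScalars ℝ ∘ₗ TensorProduct.mk ℝ ℂ L 1), ?_⟩
  ext x
  simp

theorem trivialKroneckerDim_eq_zero_of_isKilling [LieAlgebra.IsKilling ℂ (Complexified L)] :
    trivialKroneckerDim L = 0 := by
  obtain ⟨A, B, hAB⟩ := exists_pair_common_centralizer_eq_zero ℂ (Complexified L)
  obtain ⟨a, ha⟩ := ComplexDual.extend_surjective (killingForm ℂ (Complexified L) A)
  obtain ⟨b, hb⟩ := ComplexDual.extend_surjective (killingForm ℂ (Complexified L) B)
  refine trivialKroneckerDim_eq_zero_of_ker_inf_ker_eq_bot (a := a) (b := b)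
    ((Submodule.eq_bot_iff _).mpr fun u ⟨hau, hbu⟩ => ?_)
  exact hAB u (lie_eq_zero_of_linearBivector_eq_zero ha hau)
    (lie_eq_zero_of_linearBivector_eq_zero hb hbu)

end Semisimple

section LocalProduct

open Filter Topology VectorField

variable {𝕜 E : Type*} [NontriviallyNormedField 𝕜] [NormedAddCommGroup E] [NormedSpace 𝕜 E]

theorem hasFDerivAt_of_mul_eq {R : Type*} [NormedRing R] [NormedAlgebra 𝕜 R]
    [HasSummableGeomSeries R] {A B X : E → R} {A' B' : E →L[𝕜] R} {e : E}
    (hA : HasFDerivAt A A' e) (hB : HasFDerivAt B B' e) (hAe : A e = 1) (hBe : B e = 1)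
    (hX : ∀ᶠ y in 𝓝 e, B y * X y = A y) : HasFDerivAt X (A' - B') e := by
  have hBinv : HasFDerivAt (fun y => Ring.inverse (B y)) (-B') e := by
    have h := hasFDerivAt_ringInverse (𝕜 := 𝕜) (1 : Rˣ)
    rw [Units.val_one, ← hBe] at h
    refine (h.comp e hB).congr_fderiv ?_
    ext v
    simp
  have hunit : ∀ᶠ y in 𝓝 e, IsUnit (B y) :=
    hB.continuousAt.eventually_mem (Units.isOpen.mem_nhds (hBe ▸ isUnit_one))
  have hX' : X =ᶠ[𝓝 e] fun y => Ring.inverse (B y) * A y := by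
    filter_upwards [hX, hunit] with y hy hu
    rw [← hy, Ring.inverse_mul_cancel_left _ _ hu]
  refine ((hBinv.mul' hA).congr_of_eventuallyEq hX').congr_fderiv ?_
  ext v
  simp [hBe, hAe, sub_eq_add_neg]

variable (𝕜) in
/-- The left-invariant vector field with value `u` at the neutral element `e` of a local product
`m` on a normed space: the derivative of `y ↦ m (x, y)` at `e`, applied to `u`. -/
noncomputable def localInvariantField (m : E × E → E) (e u x : E) : E :=
  fderiv 𝕜 m (x, e) (0, u)

variable {m : E × E → E} {e : E}

theorem fderiv_comp_inl_eq_id (hm : DifferentiableAt 𝕜 m (e, e))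
    (hright : ∀ᶠ x in 𝓝 e, m (x, e) = x) : fderiv 𝕜 m (e, e) ∘L .inl 𝕜 E E = .id 𝕜 E :=
  (hm.hasFDerivAt.comp (f := fun x => (x, e)) e (hasFDerivAt_prodMk_left e e)).unique
    ((hasFDerivAt_id e).congr_of_eventuallyEq hright)

theorem fderiv_comp_inr_eq_id (hm : DifferentiableAt 𝕜 m (e, e))
    (hleft : ∀ᶠ x in 𝓝 e, m (e, x) = x) : fderiv 𝕜 m (e, e) ∘L .inr 𝕜 E E = .id 𝕜 E :=
  (hm.hasFDerivAt.comp (f := fun x => (e, x)) e (hasFDerivAt_prodMk_right e e)).unique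
    ((hasFDerivAt_id e).congr_of_eventuallyEq hleft)

theorem hasFDerivAt_localInvariantField (hm : DifferentiableAt 𝕜 (fderiv 𝕜 m) (e, e)) (u : E) :
    HasFDerivAt (localInvariantField 𝕜 m e u)
      ((.apply 𝕜 E ((0, u) : E × E)) ∘L fderiv 𝕜 (fderiv 𝕜 m) (e, e) ∘L .inl 𝕜 E E) e :=
  (ContinuousLinearMap.apply 𝕜 E ((0, u) : E × E)).hasFDerivAt.comp e
    (hm.hasFDerivAt.comp (f := fun x => (x, e)) e (hasFDerivAt_prodMk_left e e))

theorem lieBracket_localInvariantField (hm : DifferentiableAt 𝕜 m (e, e))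
    (hm' : DifferentiableAt 𝕜 (fderiv 𝕜 m) (e, e)) (hleft : ∀ᶠ x in 𝓝 e, m (e, x) = x)
    (v w : E) :
    lieBracket 𝕜 (localInvariantField 𝕜 m e v) (localInvariantField 𝕜 m e w) e =
      fderiv 𝕜 (fderiv 𝕜 m) (e, e) (v, 0) (0, w) -
        fderiv 𝕜 (fderiv 𝕜 m) (e, e) (w, 0) (0, v) := by
  have hvalue (u : E) : localInvariantField 𝕜 m e u e = u :=
    DFunLike.congr_fun (fderiv_comp_inr_eq_id hm hleft) u
  simp [lieBracket, (hasFDerivAt_localInvariantField hm' _).fderiv, hvalue]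

theorem exists_hasFDerivAt_eq_lieBracket_localInvariantField [CompleteSpace E]
    (hm : ContDiffAt 𝕜 (minSmoothness 𝕜 2) m (e, e)) (hright : ∀ᶠ x in 𝓝 e, m (x, e) = x)
    (hleft : ∀ᶠ x in 𝓝 e, m (e, x) = x) {Ad : E → E →L[𝕜] E}
    (hAd : ∀ᶠ y in 𝓝 e, (fderiv 𝕜 m (e, y) ∘L .inl 𝕜 E E) ∘L Ad y =
      fderiv 𝕜 m (y, e) ∘L .inr 𝕜 E E) :
    ∃ ad : E →L[𝕜] E →L[𝕜] E, HasFDerivAt Ad ad e ∧ ∀ v w, ad v w =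
      lieBracket 𝕜 (localInvariantField 𝕜 m e v) (localInvariantField 𝕜 m e w) e := by
  have hm₂ : ContDiffAt 𝕜 2 m (e, e) := hm.of_le le_minSmoothness
  have hd : DifferentiableAt 𝕜 m (e, e) := hm₂.differentiableAt (by simp)
  have hd' : DifferentiableAt 𝕜 (fderiv 𝕜 m) (e, e) :=
    (hm₂.fderiv_right (m := 1) (by norm_num)).differentiableAt (by simp)
  let restrictInl := (ContinuousLinearMap.compL 𝕜 E (E × E) E).flip (.inl 𝕜 E E)
  let restrictInr := (ContinuousLinearMap.compL 𝕜 E (E × E) E).flip (.inr 𝕜 E E)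
  have hA := restrictInr.hasFDerivAt.comp e
    (hd'.hasFDerivAt.comp (f := fun x => (x, e)) e (hasFDerivAt_prodMk_left e e))
  have hB := restrictInl.hasFDerivAt.comp e
    (hd'.hasFDerivAt.comp (f := fun x => (e, x)) e (hasFDerivAt_prodMk_right e e))
  refine ⟨_, hasFDerivAt_of_mul_eq hA hB (fderiv_comp_inr_eq_id hd hleft)
    (fderiv_comp_inl_eq_id hd hright) hAd, fun v w => ?_⟩
  have hsymm : fderiv 𝕜 (fderiv 𝕜 m) (e, e) (0, v) (w, 0) =
      fderiv 𝕜 (fderiv 𝕜 m) (e, e) (w, 0) (0, v) := hm.isSymmSndFDerivAt le_rfl _ _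
  simp [restrictInl, restrictInr, lieBracket_localInvariantField hd hd' hleft, hsymm]

end LocalProduct

section LieGroup

open Filter Topology VectorField

variable {𝕜 E H : Type*} [NontriviallyNormedField 𝕜] [NormedAddCommGroup E] [NormedSpace 𝕜 E]
  [TopologicalSpace H] {I : ModelWithCorners 𝕜 E H}

theorem hasMFDerivAt_iff_hasFDerivAt_comp_extChartAt_symm [I.Boundaryless] {F M : Type*}
    [NormedAddCommGroup F] [NormedSpace 𝕜 F] [TopologicalSpace M] [ChartedSpace H M]
    {f : M → F} {x : M} {f' : E →L[𝕜] F} :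
    HasMFDerivAt I 𝓘(𝕜, F) f x f' ↔
      HasFDerivAt (f ∘ (extChartAt I x).symm) f' (extChartAt I x x) := by
  have hwritten : writtenInExtChartAt I 𝓘(𝕜, F) x f = f ∘ (extChartAt I x).symm := by
    simp only [writtenInExtChartAt, extChartAt_model_space_eq_id, PartialEquiv.refl_coe,
      Function.id_comp]
  refine ⟨fun hf => ?_, fun hf => ⟨?_, ?_⟩⟩
  · have h := hf.2
    rw [hwritten, I.range_eq_univ] at h
    exact hasFDerivWithinAt_univ.mp h
  · refine (hf.continuousAt.comp (continuousAt_extChartAt x)).congr ?_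
    filter_upwards [extChartAt_source_mem_nhds (I := I) x] with y hy
    exact congrArg f ((extChartAt I x).left_inv hy)
  · rw [hwritten]
    exact hf.hasFDerivWithinAt

variable {G : Type*} [TopologicalSpace G] [ChartedSpace H G] [Group G]

instance [FiniteDimensional 𝕜 E] : FiniteDimensional 𝕜 (GroupLieAlgebra I G) :=
  inferInstanceAs (FiniteDimensional 𝕜 E)

instance : T2Space (GroupLieAlgebra I G) :=
  inferInstanceAs (T2Space E)

variable (I G) in
/-- The group multiplication read in the preferred chart at `1`; it is the local product of the
group only near `(chartOne I G, chartOne I G)`. -/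
noncomputable def chartMul (p : E × E) : E :=
  extChartAt I (1 : G) ((extChartAt I (1 : G)).symm p.1 * (extChartAt I (1 : G)).symm p.2)

variable (I G) in
/-- The coordinates of `1` in the preferred chart at `1`. -/
noncomputable def chartOne : E := extChartAt I (1 : G) 1

variable (I) in
/-- The adjoint action of `g` on the Lie algebra, as an endomorphism of the model space. -/
noncomputable def adjointEnd (g : G) : E →L[𝕜] E := mfderiv I I (fun x : G => g * x * g⁻¹) 1

theorem hasMFDerivAt_conj [LieGroup I 1 G] (g : G) :
    HasMFDerivAt I I (fun x : G => g * x * g⁻¹) 1 (adjointEnd I g : E →L[𝕜] E) :=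
  (((contMDiff_mul_left (I := I) (n := 1)).mul contMDiff_const).contMDiffAt.mdifferentiableAt
    one_ne_zero).hasMFDerivAt

theorem extChartAt_symm_chartOne : (extChartAt I (1 : G)).symm (chartOne I G) = 1 :=
  extChartAt_to_inv 1

theorem chartOne_mem_target : chartOne I G ∈ (extChartAt I (1 : G)).target :=
  mem_extChartAt_target 1

theorem chartMul_chartOne_right {x : E} (hx : x ∈ (extChartAt I (1 : G)).target) :
    chartMul I G (x, chartOne I G) = x := by
  rw [chartMul, extChartAt_symm_chartOne, mul_one, (extChartAt I (1 : G)).right_inv hx]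

theorem chartMul_chartOne_left {x : E} (hx : x ∈ (extChartAt I (1 : G)).target) :
    chartMul I G (chartOne I G, x) = x := by
  rw [chartMul, extChartAt_symm_chartOne, one_mul, (extChartAt I (1 : G)).right_inv hx]

variable [I.Boundaryless]

theorem contDiffAt_chartMul {n : WithTop ℕ∞} [LieGroup I n G] {x y : E}
    (hx : x ∈ (extChartAt I (1 : G)).target) (hy : y ∈ (extChartAt I (1 : G)).target)
    (hxy : (extChartAt I (1 : G)).symm x * (extChartAt I (1 : G)).symm y ∈
      (chartAt H (1 : G)).source) :
    ContDiffAt 𝕜 n (chartMul I G) (x, y) := by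
  have hsymm {u : E} (hu : u ∈ (extChartAt I (1 : G)).target) :
      ContMDiffAt 𝓘(𝕜, E) I n (extChartAt I (1 : G)).symm u :=
    (contMDiffOn_extChartAt_symm 1).contMDiffAt ((isOpen_extChartAt_target 1).mem_nhds hu)
  rw [← contMDiffAt_iff_contDiffAt]
  exact (contMDiffAt_extChartAt' hxy).comp (x, y)
    (((hsymm hx).comp (x, y) contDiff_fst.contMDiff.contMDiffAt).mul
      ((hsymm hy).comp (x, y) contDiff_snd.contMDiff.contMDiffAt))

theorem contDiffAt_chartMul_chartOne_right {n : WithTop ℕ∞} [LieGroup I n G] {x : E}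
    (hx : x ∈ (extChartAt I (1 : G)).target) :
    ContDiffAt 𝕜 n (chartMul I G) (x, chartOne I G) := by
  refine contDiffAt_chartMul hx chartOne_mem_target ?_
  rw [extChartAt_symm_chartOne, mul_one, ← extChartAt_source I]
  exact (extChartAt I (1 : G)).map_target hx

theorem contDiffAt_chartMul_chartOne_left {n : WithTop ℕ∞} [LieGroup I n G] {x : E}
    (hx : x ∈ (extChartAt I (1 : G)).target) :
    ContDiffAt 𝕜 n (chartMul I G) (chartOne I G, x) := by
  refine contDiffAt_chartMul chartOne_mem_target hx ?_
  rw [extChartAt_symm_chartOne, one_mul, ← extChartAt_source I]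
  exact (extChartAt I (1 : G)).map_target hx

variable [LieGroup I 1 G]

theorem hasMFDerivAt_extChartAt_mul_left {x : E} (hx : x ∈ (extChartAt I (1 : G)).target) :
    HasMFDerivAt I 𝓘(𝕜, E) (fun h : G => extChartAt I (1 : G) ((extChartAt I (1 : G)).symm x * h))
      1 (fderiv 𝕜 (chartMul I G) (x, chartOne I G) ∘L .inr 𝕜 E E : E →L[𝕜] E) :=
  hasMFDerivAt_iff_hasFDerivAt_comp_extChartAt_symm.mpr <|
    ((contDiffAt_chartMul_chartOne_right hx).differentiableAt one_ne_zero).hasFDerivAt.comp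
      (f := fun y => (x, y)) (chartOne I G) (hasFDerivAt_prodMk_right x (chartOne I G))

theorem hasMFDerivAt_extChartAt_mul_right {x : E} (hx : x ∈ (extChartAt I (1 : G)).target) :
    HasMFDerivAt I 𝓘(𝕜, E) (fun h : G => extChartAt I (1 : G) (h * (extChartAt I (1 : G)).symm x))
      1 (fderiv 𝕜 (chartMul I G) (chartOne I G, x) ∘L .inl 𝕜 E E : E →L[𝕜] E) :=
  hasMFDerivAt_iff_hasFDerivAt_comp_extChartAt_symm.mpr <|
    ((contDiffAt_chartMul_chartOne_left hx).differentiableAt one_ne_zero).hasFDerivAt.comp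
      (f := fun y => (y, x)) (chartOne I G) (hasFDerivAt_prodMk_left (chartOne I G) x)

/-- The relation `(g h g⁻¹) g = g h`, differentiated in `h` at `1`. -/
theorem fderiv_chartMul_comp_adjointEnd {x : E} (hx : x ∈ (extChartAt I (1 : G)).target) :
    (fderiv 𝕜 (chartMul I G) (chartOne I G, x) ∘L .inl 𝕜 E E) ∘L
        adjointEnd I ((extChartAt I (1 : G)).symm x) =
      fderiv 𝕜 (chartMul I G) (x, chartOne I G) ∘L .inr 𝕜 E E := by
  set g : G := (extChartAt I (1 : G)).symm x with hg
  have hright : HasMFDerivAt I 𝓘(𝕜, E) (fun h : G => extChartAt I (1 : G) (h * g)) (g * 1 * g⁻¹)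
      (fderiv 𝕜 (chartMul I G) (chartOne I G, x) ∘L .inl 𝕜 E E : E →L[𝕜] E) := by
    rw [mul_one, mul_inv_cancel]
    exact hasMFDerivAt_extChartAt_mul_right hx
  refine hasMFDerivAt_unique ((hright.comp 1 (hasMFDerivAt_conj g)).congr_of_eventuallyEq ?_)
    (hasMFDerivAt_extChartAt_mul_left hx)
  exact .of_forall fun h => by simp only [Function.comp_apply, inv_mul_cancel_right, hg]

theorem mpullbackWithin_mulInvariantVectorField {x : E}
    (hx : x ∈ (extChartAt I (1 : G)).target) (u : GroupLieAlgebra I G) :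
    mpullbackWithin 𝓘(𝕜, E) I (extChartAt I (1 : G)).symm (mulInvariantVectorField u)
      (Set.range I) x = localInvariantField 𝕜 (chartMul I G) (chartOne I G) u x := by
  refine (isInvertible_mfderivWithin_extChartAt_symm hx).inverse_apply_eq.mpr ?_
  set g : G := (extChartAt I (1 : G)).symm x
  let dχ : E →L[𝕜] E := mfderiv I 𝓘(𝕜, E) (extChartAt I (1 : G)) g
  let dχsymm : E →L[𝕜] E := mfderivWithin 𝓘(𝕜, E) I (extChartAt I (1 : G)).symm (Set.range I) x
  let dmul : E →L[𝕜] E := mfderiv I I (fun h : G => g * h) 1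
  have hχ : HasMFDerivAt I 𝓘(𝕜, E) (extChartAt I (1 : G)) (g * 1) dχ := by
    rw [mul_one]
    refine (mdifferentiableAt_extChartAt ?_).hasMFDerivAt
    rw [← extChartAt_source I]
    exact (extChartAt I (1 : G)).map_target hx
  have hmul : HasMFDerivAt I I (fun h : G => g * h) 1 dmul :=
    mdifferentiableAt_mul_left.hasMFDerivAt
  have hcomp : fderiv 𝕜 (chartMul I G) (x, chartOne I G) ∘L .inr 𝕜 E E = dχ ∘L dmul :=
    hasMFDerivAt_unique (hasMFDerivAt_extChartAt_mul_left hx) (hχ.comp 1 hmul)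
  have hid : dχsymm ∘L dχ = .id 𝕜 E := mfderivWithin_extChartAt_symm_comp_mfderiv_extChartAt hx
  calc dmul u = dχsymm (dχ (dmul u)) := (DFunLike.congr_fun hid (dmul u)).symm
    _ = dχsymm (localInvariantField 𝕜 (chartMul I G) (chartOne I G) u x) :=
      congrArg dχsymm (DFunLike.congr_fun hcomp u).symm

theorem lie_eq_lieBracket_localInvariantField (v w : GroupLieAlgebra I G) :
    (⁅v, w⁆ : GroupLieAlgebra I G) =
      lieBracket 𝕜 (localInvariantField 𝕜 (chartMul I G) (chartOne I G) v)
        (localInvariantField 𝕜 (chartMul I G) (chartOne I G) w) (chartOne I G) := by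
  let fieldInChart (u : GroupLieAlgebra I G) : E → E :=
    mpullbackWithin 𝓘(𝕜, E) I (extChartAt I (1 : G)).symm (mulInvariantVectorField u) (Set.range I)
  have hfield (u : GroupLieAlgebra I G) :
      fieldInChart u =ᶠ[𝓝 (chartOne I G)]
        localInvariantField 𝕜 (chartMul I G) (chartOne I G) u := by
    filter_upwards [extChartAt_target_mem_nhds (I := I) (1 : G)] with x hx
    exact mpullbackWithin_mulInvariantVectorField hx u
  have hbracket {T : E →L[𝕜] E} (hT : T = mfderiv I 𝓘(𝕜, E) (extChartAt I (1 : G)) 1) :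
      (⁅v, w⁆ : GroupLieAlgebra I G) =
        T.inverse (lieBracketWithin 𝕜 (fieldInChart v) (fieldInChart w)
          ((extChartAt I (1 : G)).symm ⁻¹' Set.univ ∩ Set.range I) (chartOne I G)) := by
    subst hT
    rfl
  rw [hbracket (T := .id 𝕜 E) (mfderiv_extChartAt_self (I := I) (x := (1 : G))).symm,
    ContinuousLinearMap.inverse_id, Set.preimage_univ, Set.univ_inter, I.range_eq_univ,
    lieBracketWithin_univ]
  exact (hfield v).lieBracket_vectorField_eq (hfield w)

theorem exists_hasMFDerivAt_adjointEnd_eq_lie [CompleteSpace E] [LieGroup I (minSmoothness 𝕜 2) G] :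
    ∃ ad : E →L[𝕜] E →L[𝕜] E, HasMFDerivAt I 𝓘(𝕜, E →L[𝕜] E) (adjointEnd I : G → _) 1 ad ∧
      ∀ v w : GroupLieAlgebra I G, ad v w = ⁅v, w⁆ := by
  have htarget := extChartAt_target_mem_nhds (I := I) (1 : G)
  obtain ⟨ad, had, hlie⟩ := exists_hasFDerivAt_eq_lieBracket_localInvariantField (𝕜 := 𝕜)
    (Ad := fun y => adjointEnd I ((extChartAt I (1 : G)).symm y))
    (contDiffAt_chartMul_chartOne_right chartOne_mem_target)
    (mem_of_superset htarget fun _ hx => chartMul_chartOne_right hx)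
    (mem_of_superset htarget fun _ hx => chartMul_chartOne_left hx)
    (mem_of_superset htarget fun _ hx => fderiv_chartMul_comp_adjointEnd hx)
  exact ⟨ad, hasMFDerivAt_iff_hasFDerivAt_comp_extChartAt_symm.mpr had, fun v w =>
    (hlie v w).trans (lie_eq_lieBracket_localInvariantField v w).symm⟩

end LieGroup

section Orbits

variable {E : Type*} [NormedAddCommGroup E] [NormedSpace ℝ E] [CompleteSpace E]
  {G : Type*} [TopologicalSpace G] [ChartedSpace E G] [Group G] [LieGroup 𝓘(ℝ, E) ∞ G]

theorem orbitDifferential_apply (z : ComplexDual (GroupLieAlgebra 𝓘(ℝ, E) G))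
    (v w : GroupLieAlgebra 𝓘(ℝ, E) G) : orbitDifferential z v w = z ⁅v, w⁆ := by
  have : LieGroup 𝓘(ℝ, E) 1 G := .of_le (n := ∞) (by norm_cast)
  have : LieGroup 𝓘(ℝ, E) (minSmoothness ℝ 2) G := .of_le (n := ∞) <| by
    rw [minSmoothness_of_isRCLikeNormedField]; norm_cast
  obtain ⟨ad, had, hlie⟩ := exists_hasMFDerivAt_adjointEnd_eq_lie (I := 𝓘(ℝ, E)) (G := G)
  let compLeft : (E →L[ℝ] E) →L[ℝ] (E →L[ℝ] ℂ) := ContinuousLinearMap.compL ℝ E E ℂ z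
  have hdifferential : orbitDifferential z = compLeft ∘L ad :=
    (compLeft.hasMFDerivAt.comp (1 : G) had).mfderiv
  calc orbitDifferential z v w = z (ad v w) := by rw [hdifferential]; rfl
    _ = z ⁅v, w⁆ := congrArg z (hlie v w)

variable [FiniteDimensional ℝ E]

variable {z : ComplexDual (GroupLieAlgebra 𝓘(ℝ, E) G)}

theorem finrank_orbitTangent_add_kroneckerDimAt :
    Module.finrank ℝ (orbitTangent z) + kroneckerDimAt z =
      Module.finrank ℂ (Complexified (GroupLieAlgebra 𝓘(ℝ, E) G)) :=
  finrank_range_add_kroneckerDimAt (z := z) (D := (orbitDifferential z : E →ₗ[ℝ] (E →L[ℝ] ℂ)))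
    (orbitDifferential_apply z)

theorem finrank_holomorphicPart_orbitTangent_add_trivialKroneckerDim
    (hz : z ∉ kroneckerIrregularitySet (GroupLieAlgebra 𝓘(ℝ, E) G)) :
    Module.finrank ℂ (holomorphicPart (orbitTangent z)) +
      trivialKroneckerDim (GroupLieAlgebra 𝓘(ℝ, E) G) =
      algebraRank (GroupLieAlgebra 𝓘(ℝ, E) G) :=
  finrank_holomorphicPart_add_trivialKroneckerDim (z := z)
    (D := (orbitDifferential z : E →ₗ[ℝ] (E →L[ℝ] ℂ))) (orbitDifferential_apply z) hz

end Orbits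

theorem mainTheorem6_general
    {E : Type*} [NormedAddCommGroup E] [NormedSpace ℝ E] [FiniteDimensional ℝ E] [CompleteSpace E]
    {G : Type*} [TopologicalSpace G] [ChartedSpace E G] [Group G] [LieGroup 𝓘(ℝ, E) ∞ G]
    {z : ComplexDual (GroupLieAlgebra 𝓘(ℝ, E) G)}
    (hz : z ∉ kroneckerIrregularitySet (GroupLieAlgebra 𝓘(ℝ, E) G)) :
    (Module.finrank ℂ (holomorphicPart (orbitTangent z)) : ℤ) =
        (algebraRank (GroupLieAlgebra 𝓘(ℝ, E) G) : ℤ) -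
          (trivialKroneckerDim (GroupLieAlgebra 𝓘(ℝ, E) G) : ℤ) ∧
    (LieAlgebra.IsKilling ℂ (Complexified (GroupLieAlgebra 𝓘(ℝ, E) G)) →
      Module.finrank ℂ (holomorphicPart (orbitTangent z)) =
        algebraRank (GroupLieAlgebra 𝓘(ℝ, E) G)) ∧
    (Module.finrank ℝ (orbitTangent z) : ℤ) =
        (Module.finrank ℂ (Complexified (GroupLieAlgebra 𝓘(ℝ, E) G)) : ℤ) -
          (trivialKroneckerDim (GroupLieAlgebra 𝓘(ℝ, E) G) : ℤ) := by
  have hCR := finrank_holomorphicPart_orbitTangent_add_trivialKroneckerDim hz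
  have hreal := finrank_orbitTangent_add_kroneckerDimAt (z := z)
  rw [kroneckerDimAt_of_notMem_kroneckerIrregularitySet hz] at hreal
  refine ⟨by lia, fun _ => ?_, by lia⟩
  rw [← hCR, trivialKroneckerDim_eq_zero_of_isKilling, add_zero]

theorem mainTheorem6
    {E : Type*} [NormedAddCommGroup E] [NormedSpace ℝ E] [FiniteDimensional ℝ E] [CompleteSpace E]
    {G : Type*} [TopologicalSpace G] [ChartedSpace E G] [Group G] [LieGroup 𝓘(ℝ, E) ∞ G]
    [ConnectedSpace G]
    (z₀ : ComplexDual (GroupLieAlgebra 𝓘(ℝ, E) G))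
    (hO : Disjoint (coadjointOrbit z₀)
      (kroneckerIrregularitySet (GroupLieAlgebra 𝓘(ℝ, E) G))) :
    (∀ z ∈ coadjointOrbit z₀,
      (Module.finrank ℂ (holomorphicPart (orbitTangent z)) : ℤ) =
        (algebraRank (GroupLieAlgebra 𝓘(ℝ, E) G) : ℤ) -
          (trivialKroneckerDim (GroupLieAlgebra 𝓘(ℝ, E) G) : ℤ)) ∧
    (LieAlgebra.IsSemisimple ℂ (Complexified (GroupLieAlgebra 𝓘(ℝ, E) G)) →
      ∀ z ∈ coadjointOrbit z₀,
        Module.finrank ℂ (holomorphicPart (orbitTangent z)) =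
          algebraRank (GroupLieAlgebra 𝓘(ℝ, E) G)) ∧
    (∀ z ∈ coadjointOrbit z₀,
      (Module.finrank ℝ (orbitTangent z) : ℤ) =
        (Module.finrank ℂ (Complexified (GroupLieAlgebra 𝓘(ℝ, E) G)) : ℤ) -
          (trivialKroneckerDim (GroupLieAlgebra 𝓘(ℝ, E) G) : ℤ)) := by
  have hgeneral (z) (hz : z ∈ coadjointOrbit z₀) :=
    mainTheorem6_general (Set.disjoint_left.mp hO hz)
  exact ⟨fun z hz => (hgeneral z hz).1, fun _ z hz => (hgeneral z hz).2.1 inferInstance,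
    fun z hz => (hgeneral z hz).2.2⟩
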